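/- **Burning number.** Let $G$ be a finite simple graph. At round $0$ all vertices are unburned. In each round $t\ge 1$ one vertex $x_t$ that was unburned at the end of round $t-1$ is chosen and becomes burned, and all neighbours of the vertices burned by the end of round $t-1$ become burned as well; burned vertices stay burned, and the process ends when all vertices are burned. The burning number $b(G)$ is the least $k$ such that all vertices of $G$ can be burned within $k$ rounds. **The graphs.** For integers $g\ge 3$ and $a_1\ge a_2\ge 1$ let $U_g^{a_1,a_2}$ be the graph of order $n=g+a_1+a_2$ obtained from a cycle $v_1v_2\cdots v_gv_1$ by attaching at the vertex $v_g$ two paths of lengths $a_1$ and $a_2$ (that is, with $a_1$ and $a_2$ new vertices). **Exceptional triples.** For integers $q,r$ put $\mathcal B=\{(2q-2,q^2-q-2,q+1),(2q-1,q^2-q-2,q+1)\}$; $B_1=\{(q^2-2,q,q),(q^2-6,q+2,q+2),(q^2-10,q+4,q+4),(q^2-3,q+1,q),(q^2-5,q+3,q),(q^2-7,q+3,q+2),(q^2-8,q+3,q+3),(q^2-7,q+5,q),(q^2-10,q+5,q+3),(q^2-11,q+5,q+4),(q^2-12,q+5,q+5),(q^2-14,q+6,q+6),(q^2-12,q+7,q+3),(q^2-14,q+7,q+5),(q^2-14,q+9,q+3)\}$;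 $B_2=\{(2q,q^2-q-2,q),(2q+2,q^2-q-6,q+2),(2q+4,q^2-q-10,q+4),(2q+1,q^2-q-3,q),(2q+3,q^2-q-5,q),(2q+3,q^2-q-7,q+2),(2q+3,q^2-q-8,q+3),(2q+5,q^2-q-7,q),(2q+5,q^2-q-10,q+3),(2q+5,q^2-q-11,q+4),(2q+5,q^2-q-12,q+5),(2q+6,q^2-q-14,q+6),(2q+7,q^2-q-12,q+3),(2q+7,q^2-q-14,q+5),(2q+9,q^2-q-14,q+3)\}$; $B_3=\{(2q,q^2-q-3,q+1),(2q,q^2-q-5,q+3),(2q+2,q^2-q-7,q+3),(2q,q^2-q-7,q+5),(2q+3,q^2-q-10,q+5),(2q+4,q^2-q-11,q+5),(2q+3,q^2-q-12,q+7),(2q+5,q^2-q-14,q+7),(2q+3,q^2-q-14,q+9)\}$; $B_4=\{(24,16,6),(22,16,8),(35,19,7),(32,19,10),(30,19,12),(28,19,14),(26,19,16),(30,21,10),(28,21,12),(45,22,11),(43,22,13),(41,22,15),(34,22,22),(43,24,11),(41,24,13),(32,24,22),(41,26,11),(60,25,12),(58,25,14),(47,25,25),(58,27,12),(47,38,12),(77,28,13)\}$;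 $B_5=\{(22,18,6),(22,16,8),(26,28,7),(26,25,10),(26,23,12),(26,21,14),(26,19,16),(28,23,10),(28,21,12),(30,37,11),(30,35,13),(30,33,15),(30,26,22),(32,35,11),(32,33,13),(32,24,22),(34,33,11),(34,51,12),(34,49,14),(34,38,25),(36,49,12),(47,38,12),(38,67,13)\}$; $B_6=\{(12,18,16),(14,16,16),(14,28,19),(17,25,19),(19,23,19),(21,21,19),(23,19,19),(17,23,21),(19,21,21),(19,37,22),(21,35,22),(23,33,22),(30,26,22),(19,35,24),(21,33,24),(30,24,24),(19,33,26),(21,51,25),(23,49,25),(34,38,25),(21,49,27),(21,38,38),(23,67,28)\}$; $\mathcal C_1=\{(2q+1,q^2-q-2,r-q+1),(q^2-2,q+1,r-q+1)\}$; $\mathcal C_2=\{(q^2-7,q+2,q+1),(2q+1,q^2-q-6,q+1),(2q+1,q^2-q-7,q+2)\}$; $\mathcal C_3=\{(q^2-3,q,q),(q^2-5,q+1,q+1),(q^2-6,q+2,q+1),(q^2-7,q+2,q+2),(q^2-7,q+3,q+1),(q^2-11,q+4,q+4),(2q+4,q^2-q-11,q+4),(2q+1,q^2-q-5,q+1),(2q+1,q^2-q-6,q+2),(2q+1,q^2-q-7,q+3),(2q+2,q^2-q-6,q+1),(2q+2,q^2-q-7,q+2),(2q+3,q^2-q-7,q+1),(2q,q^2-q-3,q),(22,16,7),(13,16,16)\}$;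 $\mathcal C_4=\{(g,a_1,a_2): g+a_1+a_2=q^2+2q-2,\ g-q\ge a_1\ge a_2=q+1\}\cup B_1\cup B_4$; $\mathcal C_5=\{(g,a_1,a_2): g+a_1+a_2=q^2+2q-2,\ a_1\ge g-q\ge a_2=q+1\}\cup B_2\cup B_5$; $\mathcal C_6=\{(g,a_1,a_2): g+a_1+a_2=q^2+2q-2,\ a_1\ge a_2\ge g-q=q+1\}\cup B_3\cup B_6$. **Theorem.** Let $g\ge 3$ and $a_1\ge a_2\ge 1$, and write the order of $U_g^{a_1,a_2}$ as $n=g+a_1+a_2=q^2+r$ with integers $q\ge 0$ and $1\le r\le 2q+1$. Suppose that at least one of the following holds: 1. $r\ge 2q-1$; 2. $3\le g\le r$; 3. $g\ge q^2+1$; 4. $a_1\ge q^2-\lfloor g/2\rfloor$; 5. $2q\le g\le q^2$ and $a_2\le r-q$; 6. $(g,a_1,a_2)\in \mathcal C_1\cup\mathcal C_2\cup\mathcal C_3\cup\mathcal C_4\cup\mathcal C_5\cup\mathcal C_6\cup\mathcal B$. Then $b(U_g^{a_1,a_2})=\lceil\sqrt n\,\rceil=q+1$. -/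

import Mathlib

namespace GraphBurning

/-! ### Graph burning -/

section Burning

variable {V : Type*} (G : SimpleGraph V)

/-- The set of vertices that are burned after `t` rounds, when `x 0, x 1, …` are the vertices chosen
in rounds `1, 2, …`: in round `t + 1` the fire spreads to the neighbours of the vertices burned so
far, and the vertex `x t` is set on fire. -/
def burnedAfter {k : ℕ} (x : Fin k → V) : ℕ → Set V
  | 0 => ∅
  | t + 1 => {v | v ∈ burnedAfter x t ∨ (∃ u ∈ burnedAfter x t, G.Adj u v) ∨
      ∃ h : t < k, v = x ⟨t, h⟩}

/-- `x` is a burning sequence of `G`: every chosen vertex is unburned when it is chosen, and all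
vertices are burned at the end of the last round. -/
def IsBurningSequence {k : ℕ} (x : Fin k → V) : Prop :=
  (∀ i : Fin k, x i ∉ burnedAfter G x i) ∧ burnedAfter G x k = Set.univ

/-- `G` can be burned in at most `k` rounds. -/
def IsBurnable (k : ℕ) : Prop :=
  ∃ j ≤ k, ∃ x : Fin j → V, IsBurningSequence G x

/-- The burning number of `G`. -/
noncomputable def burningNumber : ℕ := sInf {k | IsBurnable G k}

end Burning

/-! ### The unicyclic graphs with two arms -/

/-- The graph `U_g^{a₁,a₂}`: a cycle `v_1 ⋯ v_g` (its vertices are the elements of `Fin g`, the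
vertex `v_i` being the element `i - 1`) with two paths of `a₁` and `a₂` new vertices attached by
their first vertices to the vertex `v_g`. -/
def twoArmUnicyclic (g a₁ a₂ : ℕ) : SimpleGraph (Fin g ⊕ Fin a₁ ⊕ Fin a₂) :=
  SimpleGraph.fromRel fun x y =>
    match x, y with
    | .inl i, .inl j => (SimpleGraph.cycleGraph g).Adj i j
    | .inr (.inl i), .inr (.inl j) => (SimpleGraph.pathGraph a₁).Adj i j
    | .inr (.inr i), .inr (.inr j) => (SimpleGraph.pathGraph a₂).Adj i j
    | .inl i, .inr (.inl j) => i.val + 1 = g ∧ j.val = 0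
    | .inl i, .inr (.inr j) => i.val + 1 = g ∧ j.val = 0
    | _, _ => False

/-! ### The exceptional sets of triples `(g, a₁, a₂)` -/

def setB (q : ℤ) : Set (ℤ × ℤ × ℤ) :=
  {(2*q-2, q^2-q-2, q+1), (2*q-1, q^2-q-2, q+1)}

def setB₁ (q : ℤ) : Set (ℤ × ℤ × ℤ) :=
  {(q^2-2, q, q), (q^2-6, q+2, q+2), (q^2-10, q+4, q+4), (q^2-3, q+1, q),
   (q^2-5, q+3, q), (q^2-7, q+3, q+2), (q^2-8, q+3, q+3), (q^2-7, q+5, q),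
   (q^2-10, q+5, q+3), (q^2-11, q+5, q+4), (q^2-12, q+5, q+5), (q^2-14, q+6, q+6),
   (q^2-12, q+7, q+3), (q^2-14, q+7, q+5), (q^2-14, q+9, q+3)}

def setB₂ (q : ℤ) : Set (ℤ × ℤ × ℤ) :=
  {(2*q, q^2-q-2, q), (2*q+2, q^2-q-6, q+2), (2*q+4, q^2-q-10, q+4), (2*q+1, q^2-q-3, q),
   (2*q+3, q^2-q-5, q), (2*q+3, q^2-q-7, q+2), (2*q+3, q^2-q-8, q+3), (2*q+5, q^2-q-7, q),
   (2*q+5, q^2-q-10, q+3), (2*q+5, q^2-q-11, q+4), (2*q+5, q^2-q-12, q+5),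
   (2*q+6, q^2-q-14, q+6), (2*q+7, q^2-q-12, q+3), (2*q+7, q^2-q-14, q+5),
   (2*q+9, q^2-q-14, q+3)}

def setB₃ (q : ℤ) : Set (ℤ × ℤ × ℤ) :=
  {(2*q, q^2-q-3, q+1), (2*q, q^2-q-5, q+3), (2*q+2, q^2-q-7, q+3), (2*q, q^2-q-7, q+5),
   (2*q+3, q^2-q-10, q+5), (2*q+4, q^2-q-11, q+5), (2*q+3, q^2-q-12, q+7),
   (2*q+5, q^2-q-14, q+7), (2*q+3, q^2-q-14, q+9)}

def setB₄ : Set (ℤ × ℤ × ℤ) :=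
  {(24,16,6), (22,16,8), (35,19,7), (32,19,10), (30,19,12), (28,19,14),
   (26,19,16), (30,21,10), (28,21,12), (45,22,11), (43,22,13), (41,22,15),
   (34,22,22), (43,24,11), (41,24,13), (32,24,22), (41,26,11), (60,25,12),
   (58,25,14), (47,25,25), (58,27,12), (47,38,12), (77,28,13)}

def setB₅ : Set (ℤ × ℤ × ℤ) :=
  {(22,18,6), (22,16,8), (26,28,7), (26,25,10), (26,23,12), (26,21,14),
   (26,19,16), (28,23,10), (28,21,12), (30,37,11), (30,35,13), (30,33,15),
   (30,26,22), (32,35,11), (32,33,13), (32,24,22), (34,33,11), (34,51,12),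
   (34,49,14), (34,38,25), (36,49,12), (47,38,12), (38,67,13)}

def setB₆ : Set (ℤ × ℤ × ℤ) :=
  {(12,18,16), (14,16,16), (14,28,19), (17,25,19), (19,23,19), (21,21,19),
   (23,19,19), (17,23,21), (19,21,21), (19,37,22), (21,35,22), (23,33,22),
   (30,26,22), (19,35,24), (21,33,24), (30,24,24), (19,33,26), (21,51,25),
   (23,49,25), (34,38,25), (21,49,27), (21,38,38), (23,67,28)}

def setC₁ (q r : ℤ) : Set (ℤ × ℤ × ℤ) :=
  {(2*q+1, q^2-q-2, r-q+1), (q^2-2, q+1, r-q+1)}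

def setC₂ (q : ℤ) : Set (ℤ × ℤ × ℤ) :=
  {(q^2-7, q+2, q+1), (2*q+1, q^2-q-6, q+1), (2*q+1, q^2-q-7, q+2)}

def setC₃ (q : ℤ) : Set (ℤ × ℤ × ℤ) :=
  {(q^2-3, q, q), (q^2-5, q+1, q+1), (q^2-6, q+2, q+1), (q^2-7, q+2, q+2),
   (q^2-7, q+3, q+1), (q^2-11, q+4, q+4), (2*q+4, q^2-q-11, q+4),
   (2*q+1, q^2-q-5, q+1), (2*q+1, q^2-q-6, q+2), (2*q+1, q^2-q-7, q+3),
   (2*q+2, q^2-q-6, q+1), (2*q+2, q^2-q-7, q+2), (2*q+3, q^2-q-7, q+1),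
   (2*q, q^2-q-3, q), (22,16,7), (13,16,16)}

def setC₄ (q : ℤ) : Set (ℤ × ℤ × ℤ) :=
  {(g, a₁, a₂) | g + a₁ + a₂ = q^2+2*q-2 ∧ g - q ≥ a₁ ∧ a₁ ≥ a₂ ∧ a₂ = q+1} ∪ setB₁ q ∪ setB₄

def setC₅ (q : ℤ) : Set (ℤ × ℤ × ℤ) :=
  {(g, a₁, a₂) | g + a₁ + a₂ = q^2+2*q-2 ∧ a₁ ≥ g - q ∧ g - q ≥ a₂ ∧ a₂ = q+1} ∪ setB₂ q ∪ setB₅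

def setC₆ (q : ℤ) : Set (ℤ × ℤ × ℤ) :=
  {(g, a₁, a₂) | g + a₁ + a₂ = q^2+2*q-2 ∧ a₁ ≥ a₂ ∧ a₂ ≥ g - q ∧ g - q = q+1} ∪ setB₃ q ∪ setB₆

end GraphBurning

open GraphBurning

/-! Upper bound: deleting a cycle edge at the branching vertex leaves a spanning spider. A
three-legged spider with at most `k ^ 2` vertices is covered by balls of radii `0, …, k - 1`
(`spiderCoverable_of_le_sq`), and such a cover yields a burning (`isBurnable_of_cover`).

Lower bound: burning in `q` rounds gives a cover by balls of radii `0, …, q - 1`. Let `s` be the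
largest radius of a ball around the branching vertex lying in one of them, say the one of radius
`p`. Three segments of `a₁ - s`, `a₂ - s` and `g - (2 * s + 1)` vertices remain; every other ball
meets at most one of them, in at most `2 * ρ + 1` vertices, and the ball of radius `p` adds at most
`2 * (p - s)` (`exists_profile_of_cover`). The first `q` odd numbers sum to `q ^ 2`, so at most `q ^
2 + 2 * s` vertices are covered. This count, or its analogue on one or two branches, refutes the
numerical hypotheses. The exceptional triples nearly attain such a bound, which forces `s` to be `q
- 1` or `q - 2` and segments to be covered almost exactly by disjoint sets of odd numbers. That
fails because 2 is not a sum of distinct odd numbers, or by a finite search (`canCover`). -/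

namespace GraphBurning

/-! ### Burning sequences and covers by balls -/

section Cover

variable {V : Type*} {G : SimpleGraph V}

/-- Every vertex burned after `t` rounds lies in one of the balls around the chosen vertices, for
any function `D` which grows by at most one along edges. -/
theorem exists_source_of_mem_burnedAfter {D : V → V → ℕ} (hD : ∀ v, D v v = 0)
    (hadj : ∀ c u v, G.Adj u v → D c v ≤ D c u + 1) {j : ℕ} (x : Fin j → V) (t : ℕ) {v : V}
    (hv : v ∈ burnedAfter G x t) : ∃ i : Fin j, D (x i) v + i + 1 ≤ t := by
  induction t generalizing v with
  | zero => simp [burnedAfter] at hv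
  | succ t ih =>
    rcases hv with h | ⟨u, hu, huv⟩ | ⟨h, rfl⟩
    · obtain ⟨i, hi⟩ := ih h
      exact ⟨i, by omega⟩
    · obtain ⟨i, hi⟩ := ih hu
      have := hadj (x i) u v huv
      exact ⟨i, by omega⟩
    · exact ⟨⟨t, h⟩, by simp [hD]⟩

/-- A graph burnable in `q` rounds is covered by balls of radii `0, …, q - 1`. -/
theorem IsBurnable.exists_cover [Nonempty V] {D : V → V → ℕ} (hD : ∀ v, D v v = 0)
    (hadj : ∀ c u v, G.Adj u v → D c v ≤ D c u + 1) {q : ℕ} (h : IsBurnable G q) :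
    ∃ c : ℕ → V, ∀ v, ∃ ρ < q, D (c ρ) v ≤ ρ := by
  obtain ⟨j, hj, x, -, hx⟩ := h
  -- The source of index `i` spreads for `j - 1 - i` rounds. For `ρ ≥ j > 0` the truncated index
  -- repeats the first source; the default occurs only for `j = 0`.
  refine ⟨fun ρ => if h : j - 1 - ρ < j then x ⟨j - 1 - ρ, h⟩ else Classical.arbitrary V,
    fun v => ?_⟩
  obtain ⟨i, hi⟩ := exists_source_of_mem_burnedAfter hD hadj x j
    (show v ∈ burnedAfter G x j by simp [hx])
  have hij := i.2
  refine ⟨j - 1 - i, by omega, ?_⟩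
  have h1 : j - 1 - (j - 1 - (i : ℕ)) = i := by omega
  simp only [h1, hij, dite_true, Fin.eta]
  omega

open Classical in
/-- The vertex set on fire in a state `S`: the proposed vertex if it is unburned, otherwise any
unburned vertex. -/
noncomputable def nextSource (S : Set V) (p : V) : V :=
  if h : p ∈ S ∧ ∃ u, u ∉ S then h.2.choose else p

theorem nextSource_notMem {S : Set V} (hS : S ≠ Set.univ) (p : V) : nextSource S p ∉ S := by
  obtain ⟨u, hu⟩ := (Set.ne_univ_iff_exists_notMem S).1 hS
  unfold nextSource
  split_ifs with h
  · exact h.2.choose_spec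
  · intro hp
    exact h ⟨hp, u, hu⟩

theorem mem_or_eq_nextSource (S : Set V) (p : V) : p ∈ S ∨ p = nextSource S p := by
  unfold nextSource
  split_ifs with h
  · exact Or.inl h.1
  · exact Or.inr rfl

variable (G) in
/-- The burned sets of the greedy process that follows the proposals `c`. -/
noncomputable def greedyBurned (c : ℕ → V) : ℕ → Set V
  | 0 => ∅
  | t + 1 => {v | v ∈ greedyBurned c t ∨ (∃ u ∈ greedyBurned c t, G.Adj u v) ∨
      v = nextSource (greedyBurned c t) (c t)}

theorem burnedAfter_eq_greedyBurned (c : ℕ → V) (j t : ℕ) (ht : t ≤ j) :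
    burnedAfter G (fun i : Fin j => nextSource (greedyBurned G c i) (c i)) t =
      greedyBurned G c t := by
  induction t with
  | zero => rfl
  | succ t ih =>
    ext v
    simp only [burnedAfter, greedyBurned, ih (by omega), Set.mem_ofPred_eq]
    have : t < j := ht
    simp [this]

theorem mem_greedyBurned_succ_self (c : ℕ → V) (t : ℕ) : c t ∈ greedyBurned G c (t + 1) := by
  rcases mem_or_eq_nextSource (greedyBurned G c t) (c t) with h | h
  · exact Or.inl h
  · exact Or.inr (Or.inr h)

theorem mem_greedyBurned_add (c : ℕ → V) {u v : V} (w : G.Walk u v) (t m : ℕ)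
    (hu : u ∈ greedyBurned G c t) (hm : w.length ≤ m) : v ∈ greedyBurned G c (t + m) := by
  induction w generalizing t m with
  | nil =>
    clear hm
    induction m with
    | zero => exact hu
    | succ m ih => exact Or.inl ih
  | cons h w ih =>
    rw [SimpleGraph.Walk.length_cons] at hm
    have := ih (t + 1) (m - 1) (Or.inr (Or.inl ⟨_, hu, h⟩)) (by omega)
    rwa [show t + 1 + (m - 1) = t + m by omega] at this

/-- A graph covered by balls of radii `0, …, k - 1` is burnable in `k` rounds. -/
theorem isBurnable_of_cover {k : ℕ} (c : ℕ → V)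
    (hc : ∀ v, ∃ ρ < k, ∃ w : G.Walk (c ρ) v, w.length ≤ ρ) : IsBurnable G k := by
  classical
  have hk : greedyBurned G (fun t => c (k - 1 - t)) k = Set.univ := by
    refine Set.eq_univ_of_forall fun v => ?_
    obtain ⟨ρ, hρ, w, hw⟩ := hc v
    have h1 := mem_greedyBurned_succ_self (G := G) (fun t => c (k - 1 - t)) (k - 1 - ρ)
    simp only [show k - 1 - (k - 1 - ρ) = ρ by omega] at h1
    have := mem_greedyBurned_add _ w _ ρ h1 hw
    rwa [show k - 1 - ρ + 1 + ρ = k by omega] at this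
  -- Stopping at the first time all is burned leaves an unburned vertex to choose in every earlier
  -- round.
  have hex : ∃ t, greedyBurned G (fun t => c (k - 1 - t)) t = Set.univ := ⟨k, hk⟩
  refine ⟨Nat.find hex, Nat.find_min' hex hk, _, fun i => ?_,
    (burnedAfter_eq_greedyBurned _ _ _ le_rfl).trans (Nat.find_spec hex)⟩
  rw [burnedAfter_eq_greedyBurned _ _ _ i.2.le]
  exact nextSource_notMem (Nat.find_min hex i.2) _

end Cover

/-! ### Coordinates and the three segments -/

section Distance

variable {g a₁ a₂ : ℕ}

theorem cycleGraph_adj_val (hg : 3 ≤ g) (i j : Fin g) :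
    (SimpleGraph.cycleGraph g).Adj i j ↔ (i : ℕ) + 1 = j ∨ (j : ℕ) + 1 = i ∨
      ((i : ℕ) = 0 ∧ (j : ℕ) + 1 = g) ∨ ((j : ℕ) = 0 ∧ (i : ℕ) + 1 = g) := by
  have hi := i.2
  have hj := j.2
  rw [SimpleGraph.cycleGraph_adj', Fin.sub_def, Fin.sub_def]
  simp only
  have key : ∀ a b : ℕ, a < g → b < g →
      ((g - b + a) % g = 1 ↔ b + 1 = a ∨ (a = 0 ∧ b + 1 = g)) := by
    intro a b ha hb
    rcases lt_or_ge a b with h | h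
    · rw [Nat.mod_eq_of_lt (by omega)]
      omega
    · rw [show g - b + a = (a - b) + g by omega, Nat.add_mod_right, Nat.mod_eq_of_lt (by omega)]
      omega
  rw [key _ _ hi hj, key _ _ hj hi]
  omega

/-- The distance of a vertex from the branching vertex. -/
def depth : Fin g ⊕ Fin a₁ ⊕ Fin a₂ → ℕ
  | .inl i => min (i + 1) (g - (i + 1))
  | .inr (.inl i) => i + 1
  | .inr (.inr i) => i + 1

/-- The graph distance of `twoArmUnicyclic g a₁ a₂` in coordinates. -/
def armDist : Fin g ⊕ Fin a₁ ⊕ Fin a₂ → Fin g ⊕ Fin a₁ ⊕ Fin a₂ → ℕ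
  | .inl i, .inl j => min (Nat.dist i j) (g - Nat.dist i j)
  | .inr (.inl i), .inr (.inl j) => Nat.dist i j
  | .inr (.inr i), .inr (.inr j) => Nat.dist i j
  | x, y => depth x + depth y

theorem armDist_self (v : Fin g ⊕ Fin a₁ ⊕ Fin a₂) : armDist v v = 0 := by
  rcases v with i | i | i <;> simp [armDist]

/-- With `armDist_self`, this is all the lower bound needs; `armDist` is never identified with the
graph metric. -/
theorem armDist_le_of_adj (hg : 3 ≤ g) (c u v : Fin g ⊕ Fin a₁ ⊕ Fin a₂)
    (h : (twoArmUnicyclic g a₁ a₂).Adj u v) : armDist c v ≤ armDist c u + 1 := by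
  rw [twoArmUnicyclic, SimpleGraph.fromRel_adj] at h
  obtain ⟨-, h⟩ := h
  rcases u with ⟨u, hu⟩ | ⟨u, hu⟩ | ⟨u, hu⟩ <;> rcases v with ⟨v, hv⟩ | ⟨v, hv⟩ | ⟨v, hv⟩ <;>
    simp only [cycleGraph_adj_val hg, SimpleGraph.pathGraph_adj, or_false, false_or, or_self] at h <;>
    rcases c with ⟨c, hc⟩ | ⟨c, hc⟩ | ⟨c, hc⟩ <;>
    simp only [armDist, depth, Nat.dist] <;> omega

/-- The branch of a vertex: `0` and `1` for the arms, `2` for the cycle. -/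
def branch : Fin g ⊕ Fin a₁ ⊕ Fin a₂ → Fin 3
  | .inl _ => 2
  | .inr (.inl _) => 0
  | .inr (.inr _) => 1

/-- The sum of the sizes `2 ρ + 1` of the balls of radii `ρ ∈ X` in a path. -/
def oddSum (X : Finset ℕ) : ℕ := ∑ ρ ∈ X, (2 * ρ + 1)

/-- A segment covered by sets of prescribed sizes, one of which may have an exceptional size. -/
theorem card_le_oddSum_add {q p e : ℕ} (P : Finset ℕ) (β : ℕ → Fin 3) (b : Fin 3)
    (A : ℕ → Finset ℕ) (hP : ∀ x ∈ P, ∃ ρ < q, β ρ = b ∧ x ∈ A ρ)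
    (hA : ∀ ρ, β ρ = b → ρ ≠ p → (A ρ).card ≤ 2 * ρ + 1) (hp : β p = b → (A p).card ≤ e) :
    P.card ≤ oddSum ((((Finset.range q).erase p)).filter fun ρ => β ρ = b) +
      if β p = b then e else 0 := by
  classical
  set F := ((Finset.range q).erase p).filter fun ρ => β ρ = b with hF
  have h1 : P ⊆ F.biUnion A ∪ if β p = b then A p else ∅ := by
    intro x hx
    obtain ⟨ρ, hρ, hb, hxA⟩ := hP x hx
    rw [Finset.mem_union]
    by_cases h : ρ = p
    · subst h
      exact Or.inr (by simpa [hb] using hxA)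
    · exact Or.inl (Finset.mem_biUnion.2 ⟨ρ, by simp [hF, h, hρ, hb], hxA⟩)
  refine (Finset.card_le_card h1).trans ((Finset.card_union_le _ _).trans (add_le_add ?_ ?_))
  · refine Finset.card_biUnion_le.trans (Finset.sum_le_sum fun ρ hρ => ?_)
    rw [hF, Finset.mem_filter, Finset.mem_erase] at hρ
    exact hA ρ hρ.2 hρ.1.1
  · split_ifs with h
    · exact hp h
    · simp

/-- Restricting a cover of `twoArmUnicyclic g a₁ a₂` by balls of radii `0, …, q - 1` to the
complement of the largest ball around the branching vertex that is contained in one of them, which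
has radius `s` and lies in the ball of radius `p`, gives covers of three segments. -/
theorem exists_profile_of_cover (hg : 3 ≤ g) {q : ℕ} (c : ℕ → Fin g ⊕ Fin a₁ ⊕ Fin a₂)
    (hc : ∀ v, ∃ ρ < q, armDist (c ρ) v ≤ ρ) :
    ∃ s p : ℕ, s ≤ p ∧ p < q ∧ ∃ X Y Z : Finset ℕ, Disjoint X Y ∧ Disjoint X Z ∧ Disjoint Y Z ∧
      X ∪ Y ∪ Z = (Finset.range q).erase p ∧ ∃ e₁ e₂ e₃ : ℕ, e₁ + e₂ + e₃ = 2 * (p - s) ∧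
      a₁ - s ≤ oddSum X + e₁ ∧ a₂ - s ≤ oddSum Y + e₂ ∧ g - (2 * s + 1) ≤ oddSum Z + e₃ := by
  have hroot : ∀ v : Fin g ⊕ Fin a₁ ⊕ Fin a₂, depth v ≤ armDist v (.inl ⟨g - 1, by omega⟩) := by
    rintro (⟨i, hi⟩ | ⟨i, hi⟩ | ⟨i, hi⟩) <;> simp only [armDist, depth, Nat.dist] <;> omega
  obtain ⟨p, hp, hmax⟩ := Finset.exists_max_image
    ((Finset.range q).filter fun ρ => depth (c ρ) ≤ ρ) (fun ρ => ρ - depth (c ρ)) (by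
      obtain ⟨ρ, hρ, h⟩ := hc (.inl ⟨g - 1, by omega⟩)
      exact ⟨ρ, by simpa [hρ] using (hroot _).trans h⟩)
  simp only [Finset.mem_filter, Finset.mem_range] at hp hmax
  obtain ⟨s, hs⟩ : ∃ s, s = p - depth (c p) := ⟨_, rfl⟩
  -- By maximality no ball reaches further than `s` past the branching vertex, so outside the
  -- central ball it meets only its own branch.
  have hres : ∀ ρ < q, ρ ≤ s + depth (c ρ) := by
    intro ρ hρ
    by_contra! hlt
    have := hmax ρ ⟨hρ, by omega⟩
    omega
  have hpd : depth (c p) = p - s := by omega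
  have hdisj : ∀ b b' : Fin 3, b ≠ b' → Disjoint
      (((Finset.range q).erase p).filter fun ρ => branch (c ρ) = b)
      (((Finset.range q).erase p).filter fun ρ => branch (c ρ) = b') := by
    intro b b' hb
    rw [Finset.disjoint_filter]
    rintro ρ - h rfl
    exact hb h.symm
  refine ⟨s, p, by omega, hp.1, _, _, _, hdisj 0 1 (by decide), hdisj 0 2 (by decide),
    hdisj 1 2 (by decide), ?_, (if branch (c p) = 0 then 2 * (p - s) else 0),
    (if branch (c p) = 1 then 2 * (p - s) else 0), (if branch (c p) = 2 then 2 * (p - s) else 0),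
    ?_, ?_, ?_, ?_⟩
  · ext ρ
    simp only [Finset.mem_union, Finset.mem_filter]
    generalize branch (c ρ) = b
    fin_cases b <;> simp
  · generalize branch (c p) = b
    fin_cases b <;> simp
  · have := card_le_oddSum_add (q := q) (p := p) (e := 2 * (p - s)) (Finset.Ioc s a₁)
      -- The centre `c p` has depth `p - s`, so its ball reaches depth `2 * p - s`, which is `2 * (p
      -- - s)` beyond `s`.
      (fun ρ => branch (c ρ)) 0 (fun ρ => if ρ = p then Finset.Ioc s (depth (c ρ) + ρ) else
        Finset.Icc (depth (c ρ) - ρ) (depth (c ρ) + ρ)) ?_ ?_ ?_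
    · simpa using this
    · intro x hx
      rw [Finset.mem_Ioc] at hx
      obtain ⟨ρ, hρ, h⟩ := hc (.inr (.inl ⟨x - 1, by omega⟩))
      have hr := hres ρ hρ
      refine ⟨ρ, hρ, ?_⟩
      rcases hcρ : c ρ with ⟨i, hi⟩ | ⟨i, hi⟩ | ⟨i, hi⟩ <;>
        simp only [hcρ, armDist, depth, Nat.dist] at h hr
      · omega
      · simp only [branch, depth, true_and]
        split_ifs <;> simp only [Finset.mem_Ioc, Finset.mem_Icc] <;> omega
      · omega
    · intro ρ _ hne
      simp only [hne, if_false, Nat.card_Icc]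
      omega
    · intro _
      simp only [if_true, Nat.card_Ioc]
      omega
  · have := card_le_oddSum_add (q := q) (p := p) (e := 2 * (p - s)) (Finset.Ioc s a₂)
      (fun ρ => branch (c ρ)) 1 (fun ρ => if ρ = p then Finset.Ioc s (depth (c ρ) + ρ) else
        Finset.Icc (depth (c ρ) - ρ) (depth (c ρ) + ρ)) ?_ ?_ ?_
    · simpa using this
    · intro x hx
      rw [Finset.mem_Ioc] at hx
      obtain ⟨ρ, hρ, h⟩ := hc (.inr (.inr ⟨x - 1, by omega⟩))
      have hr := hres ρ hρ
      refine ⟨ρ, hρ, ?_⟩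
      rcases hcρ : c ρ with ⟨i, hi⟩ | ⟨i, hi⟩ | ⟨i, hi⟩ <;>
        simp only [hcρ, armDist, depth, Nat.dist] at h hr
      · omega
      · omega
      · simp only [branch, depth, true_and]
        split_ifs <;> simp only [Finset.mem_Ioc, Finset.mem_Icc] <;> omega
    · intro ρ _ hne
      simp only [hne, if_false, Nat.card_Icc]
      omega
    · intro _
      simp only [if_true, Nat.card_Ioc]
      omega
  · have hpos : ∀ v : Fin g ⊕ Fin a₁ ⊕ Fin a₂, branch v = 2 →
        ∃ i : Fin g, v = .inl i := by
      rintro (i | i | i) h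
      · exact ⟨i, rfl⟩
      · exact absurd h (by simp [branch])
      · exact absurd h (by simp [branch])
    obtain ⟨pos, hpos_inl⟩ : ∃ pos : Fin g ⊕ Fin a₁ ⊕ Fin a₂ → ℕ,
        ∀ (i : ℕ) (hi : i < g), pos (.inl ⟨i, hi⟩) = i + 1 :=
      ⟨Sum.elim (fun i => i + 1) fun _ => 0, fun _ _ => rfl⟩
    -- The cycle is cut open at the branching vertex, which is both position `0` and position `g`.
    -- The ball of radius `p` eats into the segment from the end nearer its centre.
    have := card_le_oddSum_add (q := q) (p := p) (e := 2 * (p - s)) (Finset.Ioo s (g - s))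
      (fun ρ => branch (c ρ)) 2 (fun ρ => if ρ = p then
          if 2 * pos (c ρ) ≤ g then Finset.Ioc s (pos (c ρ) + ρ)
          else Finset.Ico (pos (c ρ) - ρ) (g - s)
        else Finset.Icc (pos (c ρ) - ρ) (pos (c ρ) + ρ)) ?_ ?_ ?_
    · rw [Nat.card_Ioo] at this
      omega
    · intro x hx
      rw [Finset.mem_Ioo] at hx
      obtain ⟨ρ, hρ, h⟩ := hc (.inl ⟨x - 1, by omega⟩)
      have hr := hres ρ hρ
      refine ⟨ρ, hρ, ?_⟩
      rcases hcρ : c ρ with ⟨i, hi⟩ | ⟨i, hi⟩ | ⟨i, hi⟩ <;>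
        simp only [hcρ, armDist, depth, Nat.dist] at h hr
      · have := hpos_inl i hi
        simp only [branch, true_and]
        split_ifs <;> simp only [Finset.mem_Ioc, Finset.mem_Icc, Finset.mem_Ico] <;> omega
      · omega
      · omega
    · intro ρ _ hne
      simp only [hne, if_false, Nat.card_Icc]
      omega
    · intro hb
      obtain ⟨⟨i, hi⟩, hcp⟩ := hpos _ hb
      simp only [hcp, depth] at hpd hp
      have := hpos_inl i hi
      simp only [if_true, hcp]
      split_ifs <;> simp only [Nat.card_Ioc, Nat.card_Ico] <;> omega

end Distance

/-! ### Covering spiders and the upper bound -/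

section Spider

/-- The spider with legs of lengths `a`, `b`, `c` is covered by balls of radii `0, …, k - 1`: the
ball of radius `ρ` is centred on the leg `L ρ`, at distance `P ρ` from the head. -/
def SpiderCoverable (k a b c : ℕ) : Prop :=
  ∃ (L : ℕ → Fin 3) (P : ℕ → ℕ), ∀ j : Fin 3, ∀ d ≤ ![a, b, c] j,
    ∃ ρ < k, (L ρ = j ∧ Nat.dist (P ρ) d ≤ ρ) ∨ P ρ + d ≤ ρ

variable {k a b c : ℕ}

theorem SpiderCoverable.perm {a₀ b₀ c₀ : ℕ} (e : Equiv.Perm (Fin 3))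
    (he : ∀ j, ![a₀, b₀, c₀] j = ![a, b, c] (e j)) (h : SpiderCoverable k a b c) :
    SpiderCoverable k a₀ b₀ c₀ := by
  obtain ⟨L, P, h⟩ := h
  refine ⟨fun ρ => e.symm (L ρ), P, fun j d hd => ?_⟩
  obtain ⟨ρ, hρ, h⟩ := h (e j) d (he j ▸ hd)
  exact ⟨ρ, hρ, h.imp_left fun h => ⟨by simp [h.1], h.2⟩⟩

theorem SpiderCoverable.mono {a₀ b₀ c₀ : ℕ} (h : SpiderCoverable k a b c) (ha : a₀ ≤ a)
    (hb : b₀ ≤ b) (hc : c₀ ≤ c) : SpiderCoverable k a₀ b₀ c₀ := by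
  obtain ⟨L, P, h⟩ := h
  refine ⟨L, P, fun j d hd => h j d (hd.trans ?_)⟩
  fin_cases j <;> simpa

/-- The new ball of radius `k` covers exactly the `2 * k + 1` vertices added at the end of the first
leg. -/
theorem SpiderCoverable.extend (h : SpiderCoverable k a b c) :
    SpiderCoverable (k + 1) (a + (2 * k + 1)) b c := by
  obtain ⟨L, P, h⟩ := h
  refine ⟨fun ρ => if ρ = k then 0 else L ρ, fun ρ => if ρ = k then a + 1 + k else P ρ,
    fun j d hd => ?_⟩
  by_cases hd' : d ≤ ![a, b, c] j
  · obtain ⟨ρ, hρ, h⟩ := h j d hd'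
    exact ⟨ρ, by omega, by simpa [hρ.ne] using h⟩
  · refine ⟨k, by omega, Or.inl ?_⟩
    fin_cases j
    · simp at hd hd'
      simp only [if_true, Nat.dist]
      exact ⟨rfl, by omega⟩
    · exact absurd hd hd'
    · exact absurd hd hd'

/-- Three legs shorter than twice the largest radius, with at least six balls. -/
theorem spiderCoverable_of_short (hk : 6 ≤ k) :
    SpiderCoverable k (2 * k - 2) (2 * k - 2) (2 * k - 2) := by
  -- The largest ball sits on the head and covers depths below `k`. The next three take one leg
  -- each, from depth `k` to `k + 2 * ρ`; for `ρ = k - 4` this reaches `2 * k - 2` precisely when `k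
  -- ≥ 6`.
  refine ⟨fun ρ => if ρ + 2 = k then 0 else if ρ + 3 = k then 1 else 2,
    fun ρ => if ρ + 1 = k then 0 else k + ρ, fun j d hd => ?_⟩
  have hd : d ≤ 2 * k - 2 := by fin_cases j <;> exact hd
  by_cases h : d < k
  · exact ⟨k - 1, by omega, Or.inr (by dsimp only; rw [if_pos (by omega)]; omega)⟩
  fin_cases j
  · refine ⟨k - 2, by omega, Or.inl ⟨by dsimp only; rw [if_pos (by omega)]; rfl, ?_⟩⟩
    dsimp only
    rw [if_neg (by omega), Nat.dist]
    omega
  · refine ⟨k - 3, by omega, Or.inl ⟨by dsimp only; rw [if_neg (by omega), if_pos (by omega)]; rfl, ?_⟩⟩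
    dsimp only
    rw [if_neg (by omega), Nat.dist]
    omega
  · refine ⟨k - 4, by omega, Or.inl ⟨by dsimp only; rw [if_neg (by omega), if_neg (by omega)]; rfl, ?_⟩⟩
    dsimp only
    rw [if_neg (by omega), Nat.dist]
    omega

/-- A spider with three legs and at most `k ^ 2` vertices is covered by balls of radii
`0, …, k - 1`. -/
theorem spiderCoverable_of_le_sq (k : ℕ) : ∀ a b c : ℕ, a + b + c + 1 ≤ k ^ 2 →
    SpiderCoverable k a b c := by
  induction k with
  | zero => intro a b c h; simp at h
  | succ k ih =>
    intro a b c h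
    wlog hab : b ≤ a generalizing a b c
    · exact (this b a c (by omega) (by omega)).perm (Equiv.swap 0 1) (by
        intro j; fin_cases j <;> rfl)
    wlog hca : c ≤ a generalizing a b c
    · exact (this c b a (by omega) (by omega) (by omega)).perm (Equiv.swap 0 2) (by
        intro j; fin_cases j <;> rfl)
    wlog hbc : c ≤ b generalizing a b c
    · exact (this a c b (by omega) (by omega) (by omega) (by omega)).perm (Equiv.swap 1 2) (by
        intro j; fin_cases j <;> rfl)
    have hsq : (k + 1) ^ 2 = k ^ 2 + (2 * k + 1) := by ring
    by_cases hlong : 2 * k + 1 ≤ a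
    · have := (ih (a - (2 * k + 1)) b c (by omega)).extend
      rwa [Nat.sub_add_cancel hlong] at this
    by_cases hk : 5 ≤ k
    · exact (spiderCoverable_of_short (k := k + 1) (by omega)).mono (by omega) (by omega)
        (by omega)
    -- With at most five balls and all legs at most `2 * k`, every sorted triple is dominated by one
    -- of these.
    have h1 : SpiderCoverable 1 0 0 0 := ⟨fun _ => 0, fun _ => 0, by decide⟩
    have h2 : SpiderCoverable 2 2 1 1 := ⟨fun _ => 0, ![2, 0, 0] ∘ Fin.ofNat 3, by decide⟩
    have h3 : SpiderCoverable 3 4 3 2 :=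
      ⟨![1, 0, 0] ∘ Fin.ofNat 3, ![3, 4, 0] ∘ Fin.ofNat 3, by decide⟩
    have h3' : SpiderCoverable 3 4 4 0 :=
      ⟨![0, 1, 0] ∘ Fin.ofNat 3, ![4, 3, 1] ∘ Fin.ofNat 3, by decide⟩
    have h4 : SpiderCoverable 4 6 6 4 :=
      ⟨![2, 1, 0, 0] ∘ Fin.ofNat 4, ![4, 5, 6, 0] ∘ Fin.ofNat 4, by decide⟩
    have h4' : SpiderCoverable 4 5 5 5 :=
      ⟨![0, 1, 2, 0] ∘ Fin.ofNat 4, ![5, 4, 5, 1] ∘ Fin.ofNat 4, by decide⟩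
    have h5 : SpiderCoverable 5 8 8 8 :=
      ⟨![2, 2, 1, 0, 0] ∘ Fin.ofNat 5, ![8, 6, 7, 8, 0] ∘ Fin.ofNat 5, by decide⟩
    rcases (show k = 0 ∨ k = 1 ∨ k = 2 ∨ k = 3 ∨ k = 4 by omega) with rfl | rfl | rfl | rfl | rfl
    · exact h1.mono (by omega) (by omega) (by omega)
    · exact h2.mono (by omega) (by omega) (by omega)
    · by_cases hb : b = 4
      · exact h3'.mono (by omega) (by omega) (by omega)
      · exact h3.mono (by omega) (by omega) (by omega)
    · by_cases hc : 5 ≤ c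
      · exact h4'.mono (by omega) (by omega) (by omega)
      · exact h4.mono (by omega) (by omega) (by omega)
    · exact h5.mono (by omega) (by omega) (by omega)

/-- Stationary steps are allowed so that a leg can be continued as a constant past its end. -/
theorem exists_walk_of_step {V : Type*} {G : SimpleGraph V} (f : ℕ → V)
    (hf : ∀ n, f n = f (n + 1) ∨ G.Adj (f n) (f (n + 1))) (m n : ℕ) :
    ∃ w : G.Walk (f m) (f n), w.length ≤ Nat.dist m n := by
  have key : ∀ m l, ∃ w : G.Walk (f m) (f (m + l)), w.length ≤ l := by
    intro m l
    induction l with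
    | zero => exact ⟨.nil, le_rfl⟩
    | succ l ih =>
      obtain ⟨w, hw⟩ := ih
      rcases hf (m + l) with h | h
      · exact ⟨w.copy rfl h, by simpa using hw.trans (Nat.le_succ l)⟩
      · exact ⟨w.concat h, by simpa using hw⟩
  rcases le_total m n with h | h
  · obtain ⟨w, hw⟩ := key m (n - m)
    refine ⟨w.copy rfl (by congr 1; omega), ?_⟩
    simpa [Nat.dist_eq_sub_of_le h] using hw
  · obtain ⟨w, hw⟩ := key n (m - n)
    refine ⟨(w.copy rfl (by congr 1; omega)).reverse, ?_⟩
    simpa [Nat.dist_eq_sub_of_le_right h] using hw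

/-- The two-arm unicyclic graph of order at most `k ^ 2` is burnable in `k` rounds. -/
theorem isBurnable_twoArmUnicyclic {g a₁ a₂ : ℕ} (hg : 3 ≤ g) (ha₁ : 1 ≤ a₁) (ha₂ : 1 ≤ a₂)
    (hn : g + a₁ + a₂ ≤ k ^ 2) : IsBurnable (twoArmUnicyclic g a₁ a₂) k := by
  obtain ⟨L, P, h⟩ := spiderCoverable_of_le_sq k a₁ a₂ (g - 1) (by omega)
  -- The minima clamp centres lying beyond the end of a leg. The third leg runs `v_1, …, v_{g-1}`,
  -- so the edge from `v_{g-1}` to `v_g` is dropped.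
  let f : Fin 3 → ℕ → Fin g ⊕ Fin a₁ ⊕ Fin a₂ := fun j d =>
    if d = 0 then .inl ⟨g - 1, by omega⟩ else
      ![.inr (.inl ⟨min (d - 1) (a₁ - 1), by omega⟩), .inr (.inr ⟨min (d - 1) (a₂ - 1), by omega⟩),
        .inl ⟨min (d - 1) (g - 2), by omega⟩] j
  have hf : ∀ j n, f j n = f j (n + 1) ∨
      (twoArmUnicyclic g a₁ a₂).Adj (f j n) (f j (n + 1)) := by
    intro j n
    rw [or_iff_not_imp_left]
    intro hne
    rw [twoArmUnicyclic, SimpleGraph.fromRel_adj]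
    refine ⟨hne, ?_⟩
    rcases Nat.eq_zero_or_pos n with rfl | hn
    · fin_cases j <;> simp [f, cycleGraph_adj_val hg] <;> omega
    · fin_cases j <;>
        simp [f, hn.ne', cycleGraph_adj_val hg, SimpleGraph.pathGraph_adj] at hne ⊢ <;> omega
  have hsurj : ∀ v, ∃ j, ∃ d ≤ ![a₁, a₂, g - 1] j, f j d = v := by
    rintro (⟨i, hi⟩ | ⟨i, hi⟩ | ⟨i, hi⟩)
    · by_cases h : i + 1 = g
      · exact ⟨0, 0, by simp, by simp [f]; omega⟩
      · exact ⟨2, i + 1, by simp; omega, by simp [f]; omega⟩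
    · exact ⟨0, i + 1, by simp; omega, by simp [f]; omega⟩
    · exact ⟨1, i + 1, by simp; omega, by simp [f]; omega⟩
  refine isBurnable_of_cover (fun ρ => f (L ρ) (P ρ)) fun v => ?_
  obtain ⟨j, d, hd, rfl⟩ := hsurj v
  obtain ⟨ρ, hρ, ⟨rfl, h⟩ | h⟩ := h j d hd
  · obtain ⟨w, hw⟩ := exists_walk_of_step (f (L ρ)) (hf _) (P ρ) d
    exact ⟨ρ, hρ, w, hw.trans h⟩
  · obtain ⟨w, hw⟩ := exists_walk_of_step (f (L ρ)) (hf _) (P ρ) 0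
    obtain ⟨w', hw'⟩ := exists_walk_of_step (f j) (hf _) 0 d
    refine ⟨ρ, hρ, w.append w', ?_⟩
    rw [SimpleGraph.Walk.length_append]
    simp only [Nat.dist] at hw hw'
    omega

end Spider

/-! ### Disjoint sums of odd numbers -/

section Partition

/-- `canCover m x y b` decides whether there are disjoint sets of odd numbers less than `2 * m`
with sums at least `x` and at least `y` and total sum at most `b`. -/
def canCover : ℕ → ℕ → ℕ → ℕ → Bool
  | 0, x, y, _ => x == 0 && y == 0
  | m + 1, x, y, b => canCover m x y b || (Nat.ble (2 * m + 1) b &&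
      (canCover m (x - (2 * m + 1)) y (b - (2 * m + 1)) ||
        canCover m x (y - (2 * m + 1)) (b - (2 * m + 1))))

theorem oddSum_erase {X : Finset ℕ} {m : ℕ} (h : m ∈ X) :
    oddSum X = oddSum (X.erase m) + (2 * m + 1) :=
  (Finset.sum_erase_add X _ h).symm

/-- The search branches on whether the largest radius lies in `X`, in `Y` or in neither. Truncated
subtraction is harmless because the demands are lower bounds. -/
theorem canCover_of_subset {m x y b : ℕ} {X Y : Finset ℕ} (hXY : Disjoint X Y)
    (hX : X ⊆ Finset.range m) (hY : Y ⊆ Finset.range m) (hx : x ≤ oddSum X) (hy : y ≤ oddSum Y)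
    (hb : oddSum X + oddSum Y ≤ b) : canCover m x y b = true := by
  induction m generalizing x y b X Y with
  | zero =>
    simp only [Finset.range_zero, Finset.subset_empty] at hX hY
    subst hX hY
    simp only [oddSum, Finset.sum_empty, nonpos_iff_eq_zero] at hx hy
    simp [canCover, hx, hy]
  | succ m ih =>
    have hsub : ∀ W : Finset ℕ, W ⊆ Finset.range (m + 1) → m ∉ W → W ⊆ Finset.range m := by
      intro W hW hm i hi
      have h1 := Finset.mem_range.1 (hW hi)
      have h2 : i ≠ m := fun h => hm (h ▸ hi)
      exact Finset.mem_range.2 (by omega)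
    have herase : ∀ W : Finset ℕ, W ⊆ Finset.range (m + 1) → W.erase m ⊆ Finset.range m :=
      fun W hW => hsub _ ((Finset.erase_subset _ _).trans hW) (Finset.notMem_erase _ _)
    simp only [canCover, Bool.or_eq_true, Bool.and_eq_true, Nat.ble_eq]
    by_cases hmX : m ∈ X
    · have hmY : m ∉ Y := Finset.disjoint_left.1 hXY hmX
      have := oddSum_erase hmX
      exact Or.inr ⟨by omega, Or.inl (ih (Finset.disjoint_of_subset_left (Finset.erase_subset _ _)
        hXY) (herase X hX) (hsub Y hY hmY) (by omega) hy (by omega))⟩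
    by_cases hmY : m ∈ Y
    · have := oddSum_erase hmY
      exact Or.inr ⟨by omega, Or.inr (ih (Finset.disjoint_of_subset_right (Finset.erase_subset _ _)
        hXY) (hsub X hX hmX) (herase Y hY) hx (by omega) (by omega))⟩
    · exact Or.inl (ih hXY (hsub X hX hmX) (hsub Y hY hmY) hx hy hb)

theorem subset_range_of_oddSum_le {X : Finset ℕ} {m : ℕ} (h : oddSum X ≤ 2 * m) :
    X ⊆ Finset.range m := by
  intro i hi
  have := oddSum_erase hi
  exact Finset.mem_range.2 (by omega)

/-- A total of at most `2 * m` excludes every odd number from `2 * m + 1` on. -/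
theorem canCover_of_le {m x y b : ℕ} {X Y : Finset ℕ} (hXY : Disjoint X Y)
    (hx : x ≤ oddSum X) (hy : y ≤ oddSum Y) (hb : oddSum X + oddSum Y ≤ b) (hm : b ≤ 2 * m) :
    canCover m x y b = true :=
  canCover_of_subset hXY (subset_range_of_oddSum_le (by omega))
    (subset_range_of_oddSum_le (by omega)) hx hy hb

theorem oddSum_range (q : ℕ) : oddSum (Finset.range q) = q ^ 2 := by
  induction q with
  | zero => rfl
  | succ q ih =>
    rw [oddSum] at ih ⊢
    rw [Finset.sum_range_succ, ih]
    ring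

theorem oddSum_union {X Y : Finset ℕ} (h : Disjoint X Y) :
    oddSum (X ∪ Y) = oddSum X + oddSum Y :=
  Finset.sum_union h

end Partition

/-! ### Counting in a profile -/

section LowerBound

variable {q g a₁ a₂ : ℕ}

/-- The numerical data of a cover of `twoArmUnicyclic g a₁ a₂` by balls of radii `0, …, q - 1`;
see `exists_profile_of_cover`. -/
structure Profile (q g a₁ a₂ s p : ℕ) (X Y Z : Finset ℕ) (e₁ e₂ e₃ : ℕ) : Prop where
  le : s ≤ p
  lt : p < q
  disj₁₂ : Disjoint X Y
  disj₁₃ : Disjoint X Z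
  disj₂₃ : Disjoint Y Z
  union : X ∪ Y ∪ Z = (Finset.range q).erase p
  extra : e₁ + e₂ + e₃ = 2 * (p - s)
  arm₁ : a₁ - s ≤ oddSum X + e₁
  arm₂ : a₂ - s ≤ oddSum Y + e₂
  cycle : g - (2 * s + 1) ≤ oddSum Z + e₃

namespace Profile

variable {s p e₁ e₂ e₃ : ℕ} {X Y Z : Finset ℕ}

theorem sum_eq (h : Profile q g a₁ a₂ s p X Y Z e₁ e₂ e₃) :
    oddSum X + oddSum Y + oddSum Z + (2 * p + 1) = q ^ 2 := by
  rw [← oddSum_union h.disj₁₂, ← oddSum_union (Finset.disjoint_union_left.2 ⟨h.disj₁₃, h.disj₂₃⟩),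
    h.union, ← oddSum_erase (Finset.mem_range.2 h.lt), oddSum_range]

theorem subset_range (h : Profile q g a₁ a₂ s p X Y Z e₁ e₂ e₃) (hp : p + 1 = q) :
    X ⊆ Finset.range p ∧ Y ⊆ Finset.range p ∧ Z ⊆ Finset.range p := by
  have key : X ∪ Y ∪ Z = Finset.range p := by
    rw [h.union, ← hp, Finset.range_add_one, Finset.erase_insert (by simp)]
  rw [← key]
  refine ⟨?_, ?_, ?_⟩ <;> intro i <;> simp +contextual

/-- In order `q ^ 2 + 2 q - 2` the segments of the arms are covered exactly. -/
theorem canCover_arms (h : Profile q g a₁ a₂ s p X Y Z e₁ e₂ e₃)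
    (hn : g + a₁ + a₂ + 2 = q ^ 2 + 2 * q) {m x y : ℕ} (hx : x + q = a₁ + 1)
    (hy : y + q = a₂ + 1) (hm : x + y ≤ 2 * m ∨ m + 1 = q) : canCover m x y (x + y) = true := by
  have := h.sum_eq
  obtain ⟨h1, h2, h12, -, -, -, he, hX, hY, hZ⟩ := id h
  -- At this order the count forces `s = p = q - 1`, with no extra vertices and no slack.
  have hb : oddSum X + oddSum Y ≤ x + y := by omega
  rcases hm with hm | hm
  · exact canCover_of_le h12 (by omega) (by omega) hb hm
  · obtain ⟨hX, hY, -⟩ := h.subset_range (by omega)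
    have hpm : p = m := by omega
    subst hpm
    exact canCover_of_subset h12 hX hY (by omega) (by omega) hb

/-- In order `q ^ 2 + 2 q - 2` the segments of the cycle and the second arm are covered exactly. -/
theorem canCover_cycle_arm (h : Profile q g a₁ a₂ s p X Y Z e₁ e₂ e₃)
    (hn : g + a₁ + a₂ + 2 = q ^ 2 + 2 * q) (ha : a₂ ≤ a₁) {m x y : ℕ} (hx : x + 2 * q = g + 1)
    (hy : y + q = a₂ + 1) (hm : x + y ≤ 2 * m) : canCover m x y (x + y) = true := by
  have := h.sum_eq
  obtain ⟨h1, h2, -, -, h23, -, he, hX, hY, hZ⟩ := id h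
  exact canCover_of_le h23.symm (by omega) (by omega) (by omega) hm

end Profile

theorem exists_profile (hg : 3 ≤ g) (h : IsBurnable (twoArmUnicyclic g a₁ a₂) q) :
    ∃ s p X Y Z e₁ e₂ e₃, Profile q g a₁ a₂ s p X Y Z e₁ e₂ e₃ := by
  have : Nonempty (Fin g ⊕ Fin a₁ ⊕ Fin a₂) := ⟨.inl ⟨0, by omega⟩⟩
  obtain ⟨c, hc⟩ := h.exists_cover armDist_self (armDist_le_of_adj hg)
  obtain ⟨s, p, h1, h2, X, Y, Z, h3, h4, h5, h6, e₁, e₂, e₃, h7, h8, h9, h10⟩ :=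
    exists_profile_of_cover hg c hc
  exact ⟨s, p, X, Y, Z, e₁, e₂, e₃, h1, h2, h3, h4, h5, h6, h7, h8, h9, h10⟩

end LowerBound

/-! ### Excluding the exceptional triples -/

section Exceptional

variable {q r g a₁ a₂ s p e₁ e₂ e₃ : ℕ} {X Y Z : Finset ℕ}

theorem not_mem_setB₁ (h : Profile q g a₁ a₂ s p X Y Z e₁ e₂ e₃) :
    ((g : ℤ), (a₁ : ℤ), (a₂ : ℤ)) ∉ setB₁ q := by
  intro hm
  have hsq := Nat.cast_pow (α := ℤ) q 2
  simp only [setB₁, Set.mem_insert_iff, Set.mem_singleton_iff, Prod.mk.injEq] at hm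
  obtain ⟨x, hx⟩ : ∃ x, x + q = a₁ + 1 := ⟨a₁ + 1 - q, by omega⟩
  obtain ⟨y, hy⟩ : ∃ y, y + q = a₂ + 1 := ⟨a₂ + 1 - q, by omega⟩
  -- In every triple of the list the two demands total at most 14.
  have hc := h.canCover_arms (m := 7) (by omega) hx hy (by omega)
  have hx' : (x : ℤ) = a₁ + 1 - q := by omega
  have hy' : (y : ℤ) = a₂ + 1 - q := by omega
  revert hc
  repeat' refine Or.elim hm (fun hm => ?_) (fun hm => ?_)
  all_goals
    rw [hm.2.1] at hx'
    rw [hm.2.2] at hy'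
    ring_nf at hx' hy'
    norm_cast at hx' hy'
    subst hx' hy'
    decide +kernel

theorem not_mem_setB₂ (h : Profile q g a₁ a₂ s p X Y Z e₁ e₂ e₃) (ha : a₂ ≤ a₁) :
    ((g : ℤ), (a₁ : ℤ), (a₂ : ℤ)) ∉ setB₂ q := by
  intro hm
  have hsq := Nat.cast_pow (α := ℤ) q 2
  simp only [setB₂, Set.mem_insert_iff, Set.mem_singleton_iff, Prod.mk.injEq] at hm
  obtain ⟨x, hx⟩ : ∃ x, x + 2 * q = g + 1 := ⟨g + 1 - 2 * q, by omega⟩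
  obtain ⟨y, hy⟩ : ∃ y, y + q = a₂ + 1 := ⟨a₂ + 1 - q, by omega⟩
  have hc := h.canCover_cycle_arm (m := 7) (by omega) ha hx hy (by omega)
  have hx' : (x : ℤ) = g + 1 - 2 * q := by omega
  have hy' : (y : ℤ) = a₂ + 1 - q := by omega
  revert hc
  repeat' refine Or.elim hm (fun hm => ?_) (fun hm => ?_)
  all_goals
    rw [hm.1] at hx'
    rw [hm.2.2] at hy'
    ring_nf at hx' hy'
    norm_cast at hx' hy'
    subst hx' hy'
    decide +kernel

theorem not_mem_setB₃ (h : Profile q g a₁ a₂ s p X Y Z e₁ e₂ e₃) (ha : a₂ ≤ a₁) :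
    ((g : ℤ), (a₁ : ℤ), (a₂ : ℤ)) ∉ setB₃ q := by
  intro hm
  have hsq := Nat.cast_pow (α := ℤ) q 2
  simp only [setB₃, Set.mem_insert_iff, Set.mem_singleton_iff, Prod.mk.injEq] at hm
  obtain ⟨x, hx⟩ : ∃ x, x + 2 * q = g + 1 := ⟨g + 1 - 2 * q, by omega⟩
  obtain ⟨y, hy⟩ : ∃ y, y + q = a₂ + 1 := ⟨a₂ + 1 - q, by omega⟩
  have hc := h.canCover_cycle_arm (m := 7) (by omega) ha hx hy (by omega)
  have hx' : (x : ℤ) = g + 1 - 2 * q := by omega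
  have hy' : (y : ℤ) = a₂ + 1 - q := by omega
  revert hc
  repeat' refine Or.elim hm (fun hm => ?_) (fun hm => ?_)
  all_goals
    rw [hm.1] at hx'
    rw [hm.2.2] at hy'
    ring_nf at hx' hy'
    norm_cast at hx' hy'
    subst hx' hy'
    decide +kernel

/-- The sporadic triples. -/
theorem not_mem_setB₄₅₆ (h : Profile q g a₁ a₂ s p X Y Z e₁ e₂ e₃) (hr₁ : 1 ≤ r)
    (hr₂ : r ≤ 2 * q + 1) (hn : g + a₁ + a₂ = q ^ 2 + r) :
    ((g : ℤ), (a₁ : ℤ), (a₂ : ℤ)) ∉ setB₄ ∪ setB₅ ∪ setB₆ := by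
  -- Here `m = q - 1`, so `q ^ 2 + 2 * q - 2 = m ^ 2 + 4 * m + 1`. The search must use that only
  -- radii below `m` are available.
  have key : ∀ m : ℕ, 1 ≤ m → m ^ 2 + 4 * m + 1 = g + a₁ + a₂ → m ≤ a₁ → m ≤ a₂ →
      canCover m (a₁ - m) (a₂ - m) (a₁ - m + (a₂ - m)) = true := by
    intro m hm₁ hm h1 h2
    have hq : q = m + 1 := by
      apply le_antisymm
      · by_contra! hlt
        nlinarith
      · by_contra! hlt
        nlinarith
    subst hq
    exact h.canCover_arms (by nlinarith) (by omega) (by omega) (Or.inr rfl)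
  have hneg : ∀ m : ℕ, ¬ (1 ≤ m ∧ m ^ 2 + 4 * m + 1 = g + a₁ + a₂ ∧ m ≤ a₁ ∧ m ≤ a₂ ∧
      canCover m (a₁ - m) (a₂ - m) (a₁ - m + (a₂ - m)) = false) := by
    rintro m ⟨hm, h0, h1, h2, h3⟩
    simp [key m hm h0 h1 h2] at h3
  clear hn key h
  rintro ((hm | hm) | hm) <;>
    simp only [setB₄, setB₅, setB₆, Set.mem_insert_iff, Set.mem_singleton_iff, Prod.mk.injEq]
      at hm <;> norm_cast at hm
  all_goals
    repeat' refine Or.elim hm (fun hm => ?_) (fun hm => ?_)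
    all_goals
      obtain ⟨rfl, rfl, rfl⟩ := hm
      first
      | exact hneg 5 (by decide +kernel)
      | exact hneg 6 (by decide +kernel)
      | exact hneg 7 (by decide +kernel)
      | exact hneg 8 (by decide +kernel)
      | exact hneg 9 (by decide +kernel)

/-- The only way to write 2 with odd numbers is 1 + 1, which repeats a radius. This one obstruction
settles the infinite families. -/
theorem oddSum_ne_two (X : Finset ℕ) : oddSum X ≠ 2 := by
  intro h
  have := canCover_of_le (m := 1) (Finset.disjoint_empty_right X) h.ge (Nat.zero_le _)
    (show _ ≤ 2 by simp [oddSum] at h ⊢; omega) le_rfl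
  revert this
  decide

/-- If `canCover` fails, then disjoint sets with sums at least `x` and `y` exceed the budget. -/
theorem not_cover (x y b : ℕ) (h : canCover b x y b = false) (hXY : Disjoint X Y)
    (hx : x ≤ oddSum X) (hy : y ≤ oddSum Y) : b < oddSum X + oddSum Y := by
  by_contra! hb
  simp [canCover_of_le hXY hx hy hb (by omega : b ≤ 2 * b)] at h

/-- The count is tight with `s = q - 1`, leaving two vertices of the second arm. When `g = 2 * q -
2` the missing vertex is lost because the central ball overfills the cycle. -/
theorem not_mem_setB (h : Profile q g a₁ a₂ s p X Y Z e₁ e₂ e₃) (ha : a₂ ≤ a₁) :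
    ((g : ℤ), (a₁ : ℤ), (a₂ : ℤ)) ∉ setB q := by
  intro hm
  have hsq := Nat.cast_pow (α := ℤ) q 2
  have hsum := h.sum_eq
  have hY := oddSum_ne_two Y
  obtain ⟨h1, h2, -, -, -, -, h4, h5, h6, h7⟩ := h
  simp only [setB, Set.mem_insert_iff, Set.mem_singleton_iff, Prod.mk.injEq] at hm
  rcases hm with ⟨hg, ha₁, ha₂⟩ | ⟨hg, ha₁, ha₂⟩ <;> omega

/-- Ignoring the second arm, the count gives `a₁ + g ≤ q ^ 2 + s`, and here `a₁ + g = q ^ 2 + q -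
1`. Hence `s = q - 1`, and a segment of two vertices remains on the cycle or the first arm. -/
theorem not_mem_setC₁ (h : Profile q g a₁ a₂ s p X Y Z e₁ e₂ e₃) :
    ((g : ℤ), (a₁ : ℤ), (a₂ : ℤ)) ∉ setC₁ q r := by
  intro hm
  have hsq := Nat.cast_pow (α := ℤ) q 2
  have hsum := h.sum_eq
  have hX := oddSum_ne_two X
  have hZ := oddSum_ne_two Z
  obtain ⟨h1, h2, -, -, -, -, h4, h5, h6, h7⟩ := h
  simp only [setC₁, Set.mem_insert_iff, Set.mem_singleton_iff, Prod.mk.injEq] at hm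
  rcases hm with ⟨hg, ha₁, ha₂⟩ | ⟨hg, ha₁, ha₂⟩ <;> omega

theorem not_mem_setC₂ (h : Profile q g a₁ a₂ s p X Y Z e₁ e₂ e₃) (ha : a₂ ≤ a₁) :
    ((g : ℤ), (a₁ : ℤ), (a₂ : ℤ)) ∉ setC₂ q := by
  intro hm
  have hsq := Nat.cast_pow (α := ℤ) q 2
  have hsum := h.sum_eq
  have hXY := h.disj₁₂
  have hZY := h.disj₂₃.symm
  obtain ⟨h1, h2, -, -, -, -, h4, h5, h6, h7⟩ := h
  simp only [setC₂, Set.mem_insert_iff, Set.mem_singleton_iff, Prod.mk.injEq] at hm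
  have no₃ : ∀ e < 3, ∀ e' < 3, e + e' ≤ 2 →
      canCover (7 - (e + e')) (4 - e) (3 - e') (7 - (e + e')) = false := by decide +kernel
  have no₄ : ∀ e < 3, ∀ e' < 3, e + e' ≤ 2 →
      canCover (8 - (e + e')) (4 - e) (4 - e') (8 - (e + e')) = false := by decide +kernel
  -- The order is `q ^ 2 + 2 * q - 4`: `s = q - 1` leaves slack two, while `s = q - 2` leaves none
  -- but allows up to two extra vertices from the ball of radius `p`.
  have hs : s + 1 = q ∨ s + 2 = q := by omega
  rcases hs with hs | hs <;>
    rcases hm with ⟨hg, ha₁, ha₂⟩ | ⟨hg, ha₁, ha₂⟩ | ⟨hg, ha₁, ha₂⟩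
  · have := not_cover 3 2 7 (by decide +kernel) hXY (by omega) (by omega)
    omega
  · have := not_cover 2 2 6 (by decide +kernel) hZY (by omega) (by omega)
    omega
  · have := not_cover 2 3 7 (by decide +kernel) hZY (by omega) (by omega)
    omega
  · have := not_cover _ _ _ (no₃ e₁ (by omega) e₂ (by omega) (by omega)) hXY (by omega) (by omega)
    omega
  · have := not_cover _ _ _ (no₃ e₃ (by omega) e₂ (by omega) (by omega)) hZY (by omega) (by omega)
    omega
  · have := not_cover _ _ _ (no₄ e₃ (by omega) e₂ (by omega) (by omega)) hZY (by omega) (by omega)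
    omega

/-- The triples of order `q ^ 2 + 2 q - 3`: one vertex may be covered twice. -/
theorem not_mem_setC₃ (h : Profile q g a₁ a₂ s p X Y Z e₁ e₂ e₃) (hr₁ : 1 ≤ r)
    (hr₂ : r ≤ 2 * q + 1) (hn : g + a₁ + a₂ = q ^ 2 + r) (ha : a₂ ≤ a₁) :
    ((g : ℤ), (a₁ : ℤ), (a₂ : ℤ)) ∉ setC₃ q := by
  intro hm
  have hsq := Nat.cast_pow (α := ℤ) q 2
  have hsum := h.sum_eq
  have hXY := h.disj₁₂
  have hZY := h.disj₂₃.symm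
  have hsub := h.subset_range
  obtain ⟨h1, h2, -, -, -, -, h4, h5, h6, h7⟩ := h
  -- Again `s = p = q - 1`; the `+ 1` in the budget is the single vertex of slack.
  have arms (x y : ℕ) (hx : x + q ≤ a₁ + 1) (hy : y + q ≤ a₂ + 1)
      (hs : g + a₁ + a₂ + 3 = q ^ 2 + 2 * q) (hb : a₁ + a₂ + 2 ≤ x + y + 2 * q)
      (hc : canCover (x + y + 1) x y (x + y + 1) = false) : False := by
    have := not_cover x y _ hc hXY (by omega) (by omega)
    omega
  have cycle_arm (x y : ℕ) (hx : x + 2 * q ≤ g + 1) (hy : y + q ≤ a₂ + 1)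
      (hs : g + a₁ + a₂ + 3 = q ^ 2 + 2 * q) (hb : g + a₂ + 2 ≤ x + y + 3 * q)
      (hc : canCover (x + y + 1) x y (x + y + 1) = false) : False := by
    have := not_cover x y _ hc hZY (by omega) (by omega)
    omega
  have hq : g + a₁ + a₂ = 45 → q = 6 := by
    intro h
    apply le_antisymm <;> by_contra! hlt <;> nlinarith
  simp only [setC₃, Set.mem_insert_iff, Set.mem_singleton_iff, Prod.mk.injEq] at hm
  rcases hm with hm | hm | hm | hm | hm | hm | hm | hm | hm | hm | hm | hm | hm | hm | hm | hm
  · exact arms 1 1 (by omega) (by omega) (by omega) (by omega) (by decide +kernel)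
  · exact arms 2 2 (by omega) (by omega) (by omega) (by omega) (by decide +kernel)
  · exact arms 3 2 (by omega) (by omega) (by omega) (by omega) (by decide +kernel)
  · exact arms 3 3 (by omega) (by omega) (by omega) (by omega) (by decide +kernel)
  · exact arms 4 2 (by omega) (by omega) (by omega) (by omega) (by decide +kernel)
  · exact arms 5 5 (by omega) (by omega) (by omega) (by omega) (by decide +kernel)
  · exact cycle_arm 5 5 (by omega) (by omega) (by omega) (by omega) (by decide +kernel)
  · exact cycle_arm 2 2 (by omega) (by omega) (by omega) (by omega) (by decide +kernel)
  · exact cycle_arm 2 3 (by omega) (by omega) (by omega) (by omega) (by decide +kernel)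
  · exact cycle_arm 2 4 (by omega) (by omega) (by omega) (by omega) (by decide +kernel)
  · exact cycle_arm 3 2 (by omega) (by omega) (by omega) (by omega) (by decide +kernel)
  · exact cycle_arm 3 3 (by omega) (by omega) (by omega) (by omega) (by decide +kernel)
  · exact cycle_arm 4 2 (by omega) (by omega) (by omega) (by omega) (by decide +kernel)
  · exact cycle_arm 1 1 (by omega) (by omega) (by omega) (by omega) (by decide +kernel)
  · obtain rfl : q = 6 := hq (by omega)
    obtain rfl : p = 5 := by omega
    have := canCover_of_subset (x := 11) (y := 2) (b := 14) hXY (hsub rfl).1 (hsub rfl).2.1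
      (by omega) (by omega) (by omega)
    revert this
    decide +kernel
  · obtain rfl : q = 6 := hq (by omega)
    obtain rfl : p = 5 := by omega
    have := canCover_of_subset (x := 2) (y := 11) (b := 14) hZY (hsub rfl).2.2 (hsub rfl).2.1
      (by omega) (by omega) (by omega)
    revert this
    decide +kernel

theorem not_mem_setC₄₅₆ (h : Profile q g a₁ a₂ s p X Y Z e₁ e₂ e₃) (hr₁ : 1 ≤ r)
    (hr₂ : r ≤ 2 * q + 1) (hn : g + a₁ + a₂ = q ^ 2 + r) (ha : a₂ ≤ a₁) :
    ((g : ℤ), (a₁ : ℤ), (a₂ : ℤ)) ∉ setC₄ q ∪ setC₅ q ∪ setC₆ q := by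
  have hsp := not_mem_setB₄₅₆ h hr₁ hr₂ hn
  have hB₁ := not_mem_setB₁ h
  have hB₂ := not_mem_setB₂ h ha
  have hB₃ := not_mem_setB₃ h ha
  have hsq := Nat.cast_pow (α := ℤ) q 2
  have hsum := h.sum_eq
  have hY := oddSum_ne_two Y
  have hZ := oddSum_ne_two Z
  obtain ⟨h1, h2, -, -, -, -, h4, h5, h6, h7⟩ := h
  simp only [Set.mem_union, not_or] at hsp
  obtain ⟨⟨hB₄, hB₅⟩, hB₆⟩ := hsp
  -- The families given by equations leave a tight segment of two vertices: on the second arm in the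
  -- first two sets, on the cycle in the third.
  rintro ((((⟨hs, hm⟩ | hm) | hm) | ((⟨hs, hm⟩ | hm) | hm)) | ((⟨hs, hm⟩ | hm) | hm))
  · omega
  · exact hB₁ hm
  · exact hB₄ hm
  · omega
  · exact hB₂ hm
  · exact hB₅ hm
  · omega
  · exact hB₃ hm
  · exact hB₆ hm

end Exceptional

end GraphBurning

/-! ### The burning number -/

open GraphBurning

theorem theorem4p10 (q r g a₁ a₂ : ℕ) (hr₁ : 1 ≤ r) (hr₂ : r ≤ 2 * q + 1)
    (hg : 3 ≤ g) (ha₂ : 1 ≤ a₂) (ha : a₂ ≤ a₁) (hn : g + a₁ + a₂ = q ^ 2 + r)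
    (h : (r : ℤ) ≥ 2 * q - 1 ∨
      (3 ≤ g ∧ g ≤ r) ∨
      g ≥ q ^ 2 + 1 ∨
      (a₁ : ℤ) ≥ (q : ℤ) ^ 2 - ((g / 2 : ℕ) : ℤ) ∨
      (2 * q ≤ g ∧ g ≤ q ^ 2 ∧ (a₂ : ℤ) ≤ (r : ℤ) - q) ∨
      ((g : ℤ), (a₁ : ℤ), (a₂ : ℤ)) ∈
        setC₁ q r ∪ setC₂ q ∪ setC₃ q ∪ setC₄ q ∪ setC₅ q ∪ setC₆ q ∪ setB q) :
    burningNumber (twoArmUnicyclic g a₁ a₂) = ⌈√((g + a₁ + a₂ : ℕ) : ℝ)⌉₊ ∧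
      ⌈√((g + a₁ + a₂ : ℕ) : ℝ)⌉₊ = q + 1 := by
  have hceil : ⌈√((g + a₁ + a₂ : ℕ) : ℝ)⌉₊ = q + 1 := by
    rw [Nat.ceil_eq_iff (by omega), Nat.add_sub_cancel]
    constructor
    · refine Real.lt_sqrt_of_sq_lt ?_
      exact_mod_cast (show q ^ 2 < g + a₁ + a₂ by omega)
    · refine Real.sqrt_le_iff.2 ⟨by positivity, ?_⟩
      exact_mod_cast (show g + a₁ + a₂ ≤ (q + 1) ^ 2 by nlinarith)
  refine ⟨?_, hceil⟩
  rw [hceil]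
  have hupper : IsBurnable (twoArmUnicyclic g a₁ a₂) (q + 1) :=
    isBurnable_twoArmUnicyclic hg (ha₂.trans ha) ha₂ (by nlinarith)
  have hlower : ¬ IsBurnable (twoArmUnicyclic g a₁ a₂) q := by
    intro hb
    obtain ⟨s, p, X, Y, Z, e₁, e₂, e₃, hP⟩ := exists_profile hg hb
    have hsq := Nat.cast_pow (α := ℤ) q 2
    have hsum := hP.sum_eq
    obtain ⟨h1, h2, -, -, -, -, h4, h5, h6, h7⟩ := id hP
    -- The five numerical cases contradict, in turn, the counts `g + a₁ + a₂ ≤ q ^ 2 + 2 * s`, `a₁ +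
    -- a₂ < q ^ 2`, `g ≤ q ^ 2`, `a₁ + g / 2 < q ^ 2` and `a₁ + g ≤ q ^ 2 + s`.
    rcases h with h | h | h | h | h | ((((((h | h) | h) | h) | h) | h) | h)
    · omega
    · omega
    · omega
    · omega
    · omega
    · exact not_mem_setC₁ hP h
    · exact not_mem_setC₂ hP ha h
    · exact not_mem_setC₃ hP hr₁ hr₂ hn ha h
    · exact not_mem_setC₄₅₆ hP hr₁ hr₂ hn ha (Or.inl (Or.inl h))
    · exact not_mem_setC₄₅₆ hP hr₁ hr₂ hn ha (Or.inl (Or.inr h))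
    · exact not_mem_setC₄₅₆ hP hr₁ hr₂ hn ha (Or.inr h)
    · exact not_mem_setB hP ha h
  refine le_antisymm (Nat.sInf_le hupper) (le_csInf ⟨_, hupper⟩ fun k hk => ?_)
  by_contra! hlt
  obtain ⟨j, hj, x, hx⟩ := hk
  exact hlower ⟨j, by omega, x, hx⟩
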